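/- Let $A=(a_{ij})_{i,j\in\mathcal I}$ be an indecomposable generalized Cartan matrix of finite or affine type, let $\mathfrak g=\mathfrak g(A)$ be the corresponding complex Kac–Moody Lie algebra (that is, a finite-dimensional simple or an affine Kac–Moody Lie algebra) with Cartan subalgebra $\mathfrak h$, simple roots $\{\alpha_i\}_{i\in\mathcal I}\subset\mathfrak h^*$ and root system $\Delta=\{\beta\in\mathfrak h^*\setminus\{0\} : \mathfrak g_\beta\neq 0\}$, and let $\Delta^+=\Delta\cap\sum_{i\in\mathcal I}\mathbb Z_{\ge 0}\,\alpha_i$ be the set of positive roots. Fix a nonempty subset $I\subseteq\mathcal I$. For $x=\sum_{i\in\mathcal I}c_i\alpha_i$ with $c_i\in\mathbb C$ put $\mathrm{ht}_I(x)=\sum_{i\in I}c_i$, and let $\Delta_{I,1}=\{\gamma\in\Delta : \mathrm{ht}_I(\gamma)=1\}$. Suppose $\beta\in\Delta^+$ and $m=\mathrm{ht}_I(\beta)>0$. Then there exist roots $\gamma_1,\dots,\gamma_m\in\Delta_{I,1}$ such that $$\beta=\sum_{j=1}^m\gamma_j\qquad\text{and}\qquad \sum_{j=1}^i\gamma_j\in\Delta^+\quad\text{for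 all }1\le i\le m.$$ -/

import Mathlib

open scoped BigOperators Matrix

noncomputable section

namespace KacMoody

/-! ### Cartan matrices of finite and affine type -/

section CartanMatrices

variable {ι : Type*} [Fintype ι]

/-- Generalized Cartan matrices. -/
structure IsGCM (A : Matrix ι ι ℤ) : Prop where
  diag : ∀ i, A i i = 2
  offDiag_nonpos : ∀ i j, i ≠ j → A i j ≤ 0
  zero_iff : ∀ i j, A i j = 0 ↔ A j i = 0

/-- `A` is indecomposable: the index set is nonempty and is not the disjoint union of two nonempty
subsets with no nonzero entry of `A` linking them. -/
def IsIndecomposable (A : Matrix ι ι ℤ) : Prop :=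
  Nonempty ι ∧
    ∀ S : Set ι, S.Nonempty → Sᶜ.Nonempty → ∃ i ∈ S, ∃ j ∈ Sᶜ, A i j ≠ 0 ∨ A j i ≠ 0

/-- The integer matrix `A` with real entries. -/
abbrev realMatrix (A : Matrix ι ι ℤ) : Matrix ι ι ℝ := A.map (fun z : ℤ => (z : ℝ))

/-- The integer matrix `A` with complex entries. -/
abbrev complexMatrix (A : Matrix ι ι ℤ) : Matrix ι ι ℂ := A.map (fun z : ℤ => (z : ℂ))

/-- Indecomposable generalized Cartan matrices of finite type (the Cartan matrices of the
finite-dimensional simple complex Lie algebras). -/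
structure IsFiniteType [DecidableEq ι] (A : Matrix ι ι ℤ) : Prop where
  isGCM : IsGCM A
  indecomposable : IsIndecomposable A
  det_ne_zero : A.det ≠ 0
  exists_pos : ∃ u : ι → ℝ, (∀ i, 0 < u i) ∧ ∀ i, 0 < (realMatrix A *ᵥ u) i
  pos_or_zero : ∀ v : ι → ℝ, (∀ i, 0 ≤ (realMatrix A *ᵥ v) i) → (∀ i, 0 < v i) ∨ v = 0

/-- Indecomposable generalized Cartan matrices of affine type. -/
structure IsAffineType (A : Matrix ι ι ℤ) : Prop where
  isGCM : IsGCM A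
  indecomposable : IsIndecomposable A
  corank_one : (realMatrix A).rank + 1 = Fintype.card ι
  exists_null : ∃ u : ι → ℝ, (∀ i, 0 < u i) ∧ realMatrix A *ᵥ u = 0
  mulVec_eq_zero : ∀ v : ι → ℝ, (∀ i, 0 ≤ (realMatrix A *ᵥ v) i) → realMatrix A *ᵥ v = 0

/-- A (minimal) realization of `A` on the complex vector space `H`: linearly independent simple
roots in the dual of `H` and linearly independent simple coroots in `H`, paired by `A`, where
`dim H = 2 |ι| - rank A`. -/
structure Realization (A : Matrix ι ι ℤ) (H : Type*) [AddCommGroup H] [Module ℂ H] where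
  /-- simple roots -/
  root : ι → Module.Dual ℂ H
  /-- simple coroots -/
  coroot : ι → H
  finiteDimensional : FiniteDimensional ℂ H
  root_linearIndependent : LinearIndependent ℂ root
  coroot_linearIndependent : LinearIndependent ℂ coroot
  root_coroot : ∀ i j, root j (coroot i) = (A i j : ℂ)
  finrank_add_rank : Module.finrank ℂ H + (complexMatrix A).rank = 2 * Fintype.card ι

end CartanMatrices

/-! ### The Kac–Moody Lie algebra of a realization -/

/-- Generators: Chevalley generators `e i`, `f i`, and all elements of `H`. -/
inductive Gen (ι : Type*) (H : Type*) where
  | e : ι → Gen ι H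
  | f : ι → Gen ι H
  | h : H → Gen ι H

namespace Realization

variable {ι : Type*} [Fintype ι] {A : Matrix ι ι ℤ}
  {H : Type*} [AddCommGroup H] [Module ℂ H]

/-- A generator in the free Lie algebra. -/
abbrev gen (x : Gen ι H) : FreeLieAlgebra ℂ (Gen ι H) := FreeLieAlgebra.of ℂ x

/-- The defining relations of the auxiliary Lie algebra (no Serre relations). -/
inductive Rel (R : Realization A H) :
    FreeLieAlgebra ℂ (Gen ι H) → FreeLieAlgebra ℂ (Gen ι H) → Prop
  | h_add (x y : H) : Rel R (gen (.h (x + y))) (gen (.h x) + gen (.h y))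
  | h_smul (c : ℂ) (x : H) : Rel R (gen (.h (c • x))) (c • gen (.h x))
  | h_h (x y : H) : Rel R ⁅gen (ι := ι) (.h x), gen (ι := ι) (.h y)⁆ 0
  | e_f_same (i : ι) : Rel R ⁅gen (H := H) (.e i), gen (H := H) (.f i)⁆ (gen (.h (R.coroot i)))
  | e_f_ne (i j : ι) (hij : i ≠ j) : Rel R ⁅gen (H := H) (.e i), gen (H := H) (.f j)⁆ 0
  | h_e (x : H) (i : ι) : Rel R ⁅gen (ι := ι) (.h x), gen (H := H) (.e i)⁆
      (R.root i x • gen (.e i))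
  | h_f (x : H) (i : ι) : Rel R ⁅gen (ι := ι) (.h x), gen (H := H) (.f i)⁆
      (-(R.root i x • gen (.f i)))

/-- The ideal generated by the defining relations. -/
def relIdeal (R : Realization A H) : LieIdeal ℂ (FreeLieAlgebra ℂ (Gen ι H)) :=
  LieSubmodule.lieSpan ℂ _ {z | ∃ a b, R.Rel a b ∧ z = a - b}

/-- The auxiliary Lie algebra `𝔤̃(A)`. -/
abbrev Aux (R : Realization A H) := FreeLieAlgebra ℂ (Gen ι H) ⧸ R.relIdeal

/-- The image of a generator in `𝔤̃(A)`. -/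
def auxGen (R : Realization A H) (x : Gen ι H) : R.Aux :=
  LieSubmodule.Quotient.mk (N := R.relIdeal) (gen x)

/-- The largest ideal of `𝔤̃(A)` meeting the Cartan subalgebra trivially, obtained as the sum of all
such ideals. -/
def radical (R : Realization A H) : LieIdeal ℂ R.Aux :=
  sSup {J : LieIdeal ℂ R.Aux | ∀ x : H, R.auxGen (Gen.h x) ∈ J → R.auxGen (Gen.h x) = 0}

/-- The Kac–Moody Lie algebra `𝔤(A)`. -/
abbrev Algebra (R : Realization A H) := R.Aux ⧸ R.radical

/-- The (image in `𝔤(A)` of the) element `x` of the Cartan subalgebra `H`. -/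
def cartan (R : Realization A H) (x : H) : R.Algebra :=
  LieSubmodule.Quotient.mk (N := R.radical) (R.auxGen (Gen.h x))

/-! ### Roots and heights -/

/-- The root space `𝔤_β = {x | [h, x] = β(h) x for all h ∈ H}`. -/
def rootSpace (R : Realization A H) (β : Module.Dual ℂ H) : Submodule ℂ R.Algebra where
  carrier := {x | ∀ h : H, ⁅R.cartan h, x⁆ = β h • x}
  add_mem' := by
    intro a b ha hb h
    rw [lie_add, ha h, hb h, smul_add]
  zero_mem' := by
    intro h
    rw [lie_zero, smul_zero]
  smul_mem' := by
    intro c x hx h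
    rw [lie_smul, hx h, smul_comm]

/-- The root system `Δ`. -/
def roots (R : Realization A H) : Set (Module.Dual ℂ H) :=
  {β | β ≠ 0 ∧ R.rootSpace β ≠ ⊥}

/-- The positive roots `Δ⁺`: roots that are sums of simple roots. -/
def posRoots (R : Realization A H) : Set (Module.Dual ℂ H) :=
  {β | β ∈ R.roots ∧ ∃ c : ι → ℕ, β = ∑ i, c i • R.root i}

open Classical in
/-- The `I`-height `∑ i ∈ I, c i` of `x = ∑ i, c i • α i` (and `0` outside the span of the simple
roots); see `heightOn_sum`. -/
def heightOn (R : Realization A H) (I : Set ι) (x : Module.Dual ℂ H) : ℂ :=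
  if hx : ∃ c : ι → ℂ, x = ∑ i, c i • R.root i then ∑ i, if i ∈ I then hx.choose i else 0 else 0

open Classical in
theorem heightOn_sum (R : Realization A H) (I : Set ι) (c : ι → ℂ) :
    R.heightOn I (∑ i, c i • R.root i) = ∑ i, if i ∈ I then c i else 0 := by
  have hx : ∃ d : ι → ℂ, ∑ i, c i • R.root i = ∑ i, d i • R.root i := ⟨c, rfl⟩
  have key : hx.choose = c := by
    have h := hx.choose_spec
    have h0 : ∑ i, (hx.choose i - c i) • R.root i = 0 := by
      simp only [sub_smul, Finset.sum_sub_distrib]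
      rw [← h, sub_self]
    funext i
    exact sub_eq_zero.mp
      (Fintype.linearIndependent_iff.mp R.root_linearIndependent _ h0 i)
  rw [heightOn, dif_pos hx, key]

/-- The set `Δ_{I,1}` of roots of `I`-height one. -/
def unitRoots (R : Realization A H) (I : Set ι) : Set (Module.Dual ℂ H) :=
  {β | β ∈ R.roots ∧ R.heightOn I β = 1}

end Realization

end KacMoody

end

noncomputable section

namespace KacMoody

namespace Realization

/-! ### Generators and relations in `𝔤(A)`. -/

variable {ι : Type*} [Fintype ι] {A : Matrix ι ι ℤ}
  {H : Type*} [AddCommGroup H] [Module ℂ H] (R : Realization A H)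

/-! The algebra `𝔤(A)` is spanned by the Cartan part and by iterated brackets of the `e i` and of
the `f i`, each of these a weight vector. Weight spaces are independent, so the root space of `β`
contains a nonzero monomial `⁅e i₁, ⁅e i₂, …⁆⁆` (`exists_isPosMonomial_ne_zero`).

A factor `e i` with `i ∉ I` has `I`-height zero and acts as a derivation, so by Jacobi it can be
absorbed into factors of height one. The monomial thus becomes a sum of chains `⁅z_m, ⁅…, ⁅z_2,
z_1⁆⁆⁆` of weight `β`, each `z_j` of `I`-height one (`IsPosMonomial.mem_unitChainSpan`). Some chain
is nonzero. All its factors and inner brackets are then nonzero: the weights of the factors are the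
`γ_j`, and those of the inner brackets are the partial sums (`IsUnitChain.exists_unitRoots`). -/

/-- The projection from the free Lie algebra to `𝔤(A)`. -/
def proj : FreeLieAlgebra ℂ (Gen ι H) →ₗ⁅ℂ⁆ R.Algebra where
  toFun x := LieSubmodule.Quotient.mk (N := R.radical) (LieSubmodule.Quotient.mk (N := R.relIdeal) x)
  map_add' _ _ := rfl
  map_smul' _ _ := rfl
  map_lie' := rfl

theorem proj_surjective : Function.Surjective R.proj := by
  intro x
  obtain ⟨y, rfl⟩ := LieSubmodule.Quotient.surjective_mk' R.radical x
  obtain ⟨z, rfl⟩ := LieSubmodule.Quotient.surjective_mk' R.relIdeal y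
  exact ⟨z, rfl⟩

variable {R} in
theorem proj_eq_of_rel {a b : FreeLieAlgebra ℂ (Gen ι H)} (h : R.Rel a b) :
    R.proj a = R.proj b := by
  have hmem : a - b ∈ R.relIdeal := LieSubmodule.subset_lieSpan ⟨a, b, h, rfl⟩
  have h0 : LieSubmodule.Quotient.mk (N := R.relIdeal) (a - b) = 0 :=
    (LieSubmodule.Quotient.mk_eq_zero' (N := R.relIdeal)).mpr hmem
  rw [← sub_eq_zero, ← map_sub]
  change LieSubmodule.Quotient.mk (N := R.radical)
    (LieSubmodule.Quotient.mk (N := R.relIdeal) (a - b)) = 0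
  rw [h0]
  rfl

/-- The Chevalley generator `e i` in `𝔤(A)`. -/
def e (i : ι) : R.Algebra := R.proj (gen (.e i))

/-- The Chevalley generator `f i` in `𝔤(A)`. -/
def f (i : ι) : R.Algebra := R.proj (gen (.f i))

theorem cartan_eq_proj (x : H) : R.cartan x = R.proj (gen (.h x)) := rfl

theorem cartan_add (x y : H) : R.cartan (x + y) = R.cartan x + R.cartan y := by
  simpa [cartan_eq_proj] using proj_eq_of_rel (Rel.h_add (R := R) x y)

theorem cartan_smul (c : ℂ) (x : H) : R.cartan (c • x) = c • R.cartan x := by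
  simpa [cartan_eq_proj] using proj_eq_of_rel (Rel.h_smul (R := R) c x)

theorem cartan_lie_cartan (x y : H) : ⁅R.cartan x, R.cartan y⁆ = 0 := by
  simpa [cartan_eq_proj] using proj_eq_of_rel (Rel.h_h (R := R) x y)

theorem e_lie_f_same (i : ι) : ⁅R.e i, R.f i⁆ = R.cartan (R.coroot i) := by
  simpa [cartan_eq_proj, e, f] using proj_eq_of_rel (Rel.e_f_same (R := R) i)

theorem e_lie_f_ne {i j : ι} (hij : i ≠ j) : ⁅R.e i, R.f j⁆ = 0 := by
  simpa [e, f] using proj_eq_of_rel (Rel.e_f_ne (R := R) i j hij)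

theorem cartan_lie_e (x : H) (i : ι) : ⁅R.cartan x, R.e i⁆ = R.root i x • R.e i := by
  simpa [cartan_eq_proj, e] using proj_eq_of_rel (Rel.h_e (R := R) x i)

theorem cartan_lie_f (x : H) (i : ι) : ⁅R.cartan x, R.f i⁆ = -(R.root i x • R.f i) := by
  simpa [cartan_eq_proj, f] using proj_eq_of_rel (Rel.h_f (R := R) x i)

theorem e_lie_f_mem_range (i j : ι) : ∃ h : H, ⁅R.e i, R.f j⁆ = R.cartan h := by
  by_cases hij : i = j
  · subst hij
    exact ⟨_, R.e_lie_f_same i⟩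
  · refine ⟨0, ?_⟩
    have h0 := R.cartan_smul 0 0
    rw [zero_smul, zero_smul] at h0
    rw [R.e_lie_f_ne hij, h0]

/-- A Lie subalgebra of `𝔤(A)` that contains all generators is everything. -/
theorem mem_of_generators_mem (S : LieSubalgebra ℂ R.Algebra) (he : ∀ i, R.e i ∈ S)
    (hf : ∀ i, R.f i ∈ S) (hh : ∀ h, R.cartan h ∈ S) (x : R.Algebra) : x ∈ S := by
  have hgen : ∀ g : Gen ι H, R.proj (gen g) ∈ S
    | .e i => he i
    | .f i => hf i
    | .h x => hh x
  -- A homomorphism out of the free Lie algebra is determined on generators, so `proj` factors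
  -- through `S`.
  have hcomp : R.proj = S.incl.comp (FreeLieAlgebra.lift ℂ fun g => (⟨_, hgen g⟩ : S)) := by
    apply FreeLieAlgebra.hom_ext
    intro g
    simp
  obtain ⟨y, rfl⟩ := R.proj_surjective x
  rw [hcomp]
  exact Subtype.property _

/-- A subspace of `𝔤(A)` that contains all generators and is stable under bracketing with them is
everything. -/
theorem eq_top_of_generators_lie_mem (V : Submodule ℂ R.Algebra)
    (he : ∀ i, R.e i ∈ V) (hf : ∀ i, R.f i ∈ V) (hh : ∀ h, R.cartan h ∈ V)
    (hle : ∀ i, ∀ x ∈ V, ⁅R.e i, x⁆ ∈ V) (hlf : ∀ i, ∀ x ∈ V, ⁅R.f i, x⁆ ∈ V)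
    (hlh : ∀ h, ∀ x ∈ V, ⁅R.cartan h, x⁆ ∈ V) : V = ⊤ := by
  -- By Jacobi the stabilizer of `V` is a subalgebra; containing the generators, it is everything.
  -- Hence `V` is itself closed under brackets and the same criterion applies to it.
  let N : LieSubalgebra ℂ R.Algebra :=
    { carrier := {y | ∀ x ∈ V, ⁅y, x⁆ ∈ V}
      add_mem' := fun ha hb x hx => by
        rw [add_lie]
        exact V.add_mem (ha x hx) (hb x hx)
      zero_mem' := fun x _ => by
        rw [zero_lie]
        exact V.zero_mem
      smul_mem' := fun c y hy x hx => by
        rw [smul_lie]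
        exact V.smul_mem c (hy x hx)
      lie_mem' := fun {a b} ha hb x hx => by
        rw [lie_lie]
        exact V.sub_mem (ha _ (hb x hx)) (hb _ (ha x hx)) }
  have hN : ∀ y, y ∈ N := R.mem_of_generators_mem N hle hlf hlh
  let S : LieSubalgebra ℂ R.Algebra := { V with lie_mem' := fun {a b} _ hb => hN a b hb }
  exact eq_top_iff.mpr fun x _ => R.mem_of_generators_mem S he hf hh x

/-! ### Weights -/

/-- The weight `∑ i, c i • α i`. -/
def weight (c : ι → ℕ) : Module.Dual ℂ H := ∑ i, c i • R.root i

theorem weight_add (c d : ι → ℕ) : R.weight (c + d) = R.weight c + R.weight d := by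
  simp [weight, add_smul, Finset.sum_add_distrib]

theorem weight_single [DecidableEq ι] (i : ι) : R.weight (Pi.single i 1) = R.root i := by
  simp [weight, Pi.single_apply, ite_smul]

theorem weight_eq_sum_cast (c : ι → ℕ) : R.weight c = ∑ i, (c i : ℂ) • R.root i := by
  simp [weight, Nat.cast_smul_eq_nsmul]

/-- Linear independence forces `c + d = 0`, and the entries are natural numbers, so `c = 0`. -/
theorem weight_ne_neg_weight {c d : ι → ℕ} (hc : R.weight c ≠ 0) :
    R.weight c ≠ -R.weight d := by
  intro h
  have h0 : ∑ i, ((c i : ℂ) + d i) • R.root i = 0 := by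
    simp only [add_smul, Finset.sum_add_distrib, ← weight_eq_sum_cast]
    rw [h, neg_add_cancel]
  have hcoef := Fintype.linearIndependent_iff.mp R.root_linearIndependent _ h0
  apply hc
  rw [weight]
  refine Finset.sum_eq_zero fun i _ => ?_
  have hi : c i + d i = 0 := by exact_mod_cast hcoef i
  rw [show c i = 0 by omega, zero_smul]

open Classical in
/-- The `I`-height of a tuple of multiplicities of simple roots. -/
def tupleHeight (I : Set ι) (c : ι → ℕ) : ℕ := ∑ i, if i ∈ I then c i else 0

theorem tupleHeight_add (I : Set ι) (c d : ι → ℕ) :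
    tupleHeight I (c + d) = tupleHeight I c + tupleHeight I d := by
  rw [tupleHeight, tupleHeight, tupleHeight, ← Finset.sum_add_distrib]
  refine Finset.sum_congr rfl fun i _ => ?_
  split_ifs <;> simp

theorem tupleHeight_single_of_mem [DecidableEq ι] {I : Set ι} {i : ι} (hi : i ∈ I) :
    tupleHeight I (Pi.single i 1) = 1 := by
  rw [tupleHeight, Finset.sum_eq_single i] <;> simp +contextual [hi]

theorem tupleHeight_single_of_notMem [DecidableEq ι] {I : Set ι} {i : ι} (hi : i ∉ I) :
    tupleHeight I (Pi.single i 1) = 0 := by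
  rw [tupleHeight]
  refine Finset.sum_eq_zero fun j _ => ?_
  by_cases hj : j = i
  · simp [hj, hi]
  · simp [hj]

theorem heightOn_weight (I : Set ι) (c : ι → ℕ) :
    R.heightOn I (R.weight c) = (tupleHeight I c : ℂ) := by
  rw [weight_eq_sum_cast, heightOn_sum, tupleHeight]
  push_cast
  rfl

/-! ### Root spaces and their independence. -/

variable {R}

theorem lie_mem_rootSpace {β γ : Module.Dual ℂ H} {x y : R.Algebra}
    (hx : x ∈ R.rootSpace β) (hy : y ∈ R.rootSpace γ) : ⁅x, y⁆ ∈ R.rootSpace (β + γ) := by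
  intro h
  rw [leibniz_lie, hx h, hy h, smul_lie, lie_smul, ← add_smul, LinearMap.add_apply]

theorem lie_mem_rootSpace_weight {c d : ι → ℕ} {x y : R.Algebra}
    (hx : x ∈ R.rootSpace (R.weight c)) (hy : y ∈ R.rootSpace (R.weight d)) :
    ⁅x, y⁆ ∈ R.rootSpace (R.weight (c + d)) := by
  rw [weight_add]
  exact lie_mem_rootSpace hx hy

theorem e_mem_rootSpace (i : ι) : R.e i ∈ R.rootSpace (R.root i) :=
  fun h => R.cartan_lie_e h i

theorem f_mem_rootSpace (i : ι) : R.f i ∈ R.rootSpace (-R.root i) := by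
  intro h
  rw [cartan_lie_f, LinearMap.neg_apply, neg_smul]

theorem cartan_mem_rootSpace (h : H) : R.cartan h ∈ R.rootSpace 0 := by
  intro x
  rw [cartan_lie_cartan, LinearMap.zero_apply, zero_smul]

variable (R) in
theorem iSupIndep_rootSpace : iSupIndep R.rootSpace := by
  let φ : H → Module.End ℂ R.Algebra := fun h => LieAlgebra.ad ℂ R.Algebra (R.cartan h)
  have hcomm (x y : H) : Commute (φ x) (φ y) := by
    refine LinearMap.ext fun z => ?_
    simp only [φ, Module.End.mul_apply, LieAlgebra.ad_apply]
    rw [leibniz_lie, cartan_lie_cartan, zero_lie, zero_add]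
  -- Root spaces are simultaneous eigenspaces of the commuting operators `ad h`, so they lie in the
  -- independent simultaneous generalized eigenspaces, indexed by all functions `H → ℂ`.
  have hind := Module.End.independent_iInf_maxGenEigenspace_of_forall_mapsTo φ
    fun i j μ => Module.End.mapsTo_maxGenEigenspace_of_comm (hcomm j i) μ
  refine (hind.comp (f := fun β : Module.Dual ℂ H => (β : H → ℂ))
    DFunLike.coe_injective).mono fun β x hx => ?_
  rw [Function.comp_apply, Submodule.mem_iInf]
  intro h
  refine Module.End.mem_maxGenEigenspace _ _ _ |>.mpr ⟨1, ?_⟩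
  rw [pow_one, LinearMap.sub_apply]
  simpa [φ, sub_eq_zero] using hx h

/-! ### Spanning by monomials -/

theorem lie_mem_of_mem_span {S : Set R.Algebra} {V : Submodule ℂ R.Algebra} {a : R.Algebra}
    (h : ∀ x ∈ S, ⁅a, x⁆ ∈ V) {x : R.Algebra} (hx : x ∈ Submodule.span ℂ S) : ⁅a, x⁆ ∈ V := by
  have hle : Submodule.span ℂ S ≤
      V.comap (LieAlgebra.ad ℂ R.Algebra a : R.Algebra →ₗ[ℂ] R.Algebra) :=
    Submodule.span_le.mpr h
  exact hle hx

theorem cartan_lie_mem_span {S : Set R.Algebra} (hS : ∀ x ∈ S, ∃ β, x ∈ R.rootSpace β) (h : H)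
    {x : R.Algebra} (hx : x ∈ Submodule.span ℂ S) : ⁅R.cartan h, x⁆ ∈ Submodule.span ℂ S := by
  refine lie_mem_of_mem_span (fun y hy => ?_) hx
  obtain ⟨β, hβ⟩ := hS y hy
  rw [hβ h]
  exact Submodule.smul_mem _ _ (Submodule.subset_span hy)

variable (R) in
/-- The image of the Cartan subalgebra. -/
def cartanPart : Submodule ℂ R.Algebra where
  carrier := Set.range R.cartan
  add_mem' := by
    rintro _ _ ⟨x, rfl⟩ ⟨y, rfl⟩
    exact ⟨x + y, R.cartan_add x y⟩
  zero_mem' := ⟨0, by simpa using R.cartan_smul 0 0⟩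
  smul_mem' := by
    rintro c _ ⟨x, rfl⟩
    exact ⟨c • x, R.cartan_smul c x⟩

section Monomials

variable [DecidableEq ι]

variable (R) in
/-- Iterated brackets `⁅e i₁, ⁅e i₂, …⁆⁆`, with the multiplicities of the simple roots. -/
inductive IsPosMonomial : R.Algebra → (ι → ℕ) → Prop
  | gen (i : ι) : IsPosMonomial (R.e i) (Pi.single i 1)
  | lie (i : ι) {x : R.Algebra} {c : ι → ℕ} (hx : IsPosMonomial x c) :
      IsPosMonomial ⁅R.e i, x⁆ (Pi.single i 1 + c)

variable (R) in
/-- Iterated brackets `⁅f i₁, ⁅f i₂, …⁆⁆`, with the multiplicities of the negative simple roots. -/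
inductive IsNegMonomial : R.Algebra → (ι → ℕ) → Prop
  | gen (i : ι) : IsNegMonomial (R.f i) (Pi.single i 1)
  | lie (i : ι) {x : R.Algebra} {c : ι → ℕ} (hx : IsNegMonomial x c) :
      IsNegMonomial ⁅R.f i, x⁆ (Pi.single i 1 + c)

theorem IsPosMonomial.mem_rootSpace {x : R.Algebra} {c : ι → ℕ} (hx : R.IsPosMonomial x c) :
    x ∈ R.rootSpace (R.weight c) := by
  induction hx with
  | gen i =>
    rw [weight_single]
    exact e_mem_rootSpace i
  | lie i _ ih =>
    rw [weight_add, weight_single]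
    exact lie_mem_rootSpace (e_mem_rootSpace i) ih

theorem IsNegMonomial.mem_rootSpace {x : R.Algebra} {c : ι → ℕ} (hx : R.IsNegMonomial x c) :
    x ∈ R.rootSpace (-R.weight c) := by
  induction hx with
  | gen i =>
    rw [weight_single]
    exact f_mem_rootSpace i
  | lie i _ ih =>
    rw [weight_add, weight_single, neg_add]
    exact lie_mem_rootSpace (f_mem_rootSpace i) ih

variable (R) in
/-- The span of the positive monomials. -/
def posPart : Submodule ℂ R.Algebra := Submodule.span ℂ {x | ∃ c, R.IsPosMonomial x c}

variable (R) in
/-- The span of the negative monomials. -/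
def negPart : Submodule ℂ R.Algebra := Submodule.span ℂ {x | ∃ c, R.IsNegMonomial x c}

theorem e_lie_mem_posPart (i : ι) {x : R.Algebra} (hx : x ∈ R.posPart) : ⁅R.e i, x⁆ ∈ R.posPart :=
  lie_mem_of_mem_span (by rintro _ ⟨_, hc⟩; exact Submodule.subset_span ⟨_, hc.lie i⟩) hx

theorem f_lie_mem_negPart (i : ι) {x : R.Algebra} (hx : x ∈ R.negPart) : ⁅R.f i, x⁆ ∈ R.negPart :=
  lie_mem_of_mem_span (by rintro _ ⟨_, hc⟩; exact Submodule.subset_span ⟨_, hc.lie i⟩) hx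

theorem cartan_lie_mem_posPart (h : H) {x : R.Algebra} (hx : x ∈ R.posPart) :
    ⁅R.cartan h, x⁆ ∈ R.posPart :=
  cartan_lie_mem_span (by rintro _ ⟨_, hc⟩; exact ⟨_, hc.mem_rootSpace⟩) h hx

theorem cartan_lie_mem_negPart (h : H) {x : R.Algebra} (hx : x ∈ R.negPart) :
    ⁅R.cartan h, x⁆ ∈ R.negPart :=
  cartan_lie_mem_span (by rintro _ ⟨_, hc⟩; exact ⟨_, hc.mem_rootSpace⟩) h hx

theorem e_mem_posPart (i : ι) : R.e i ∈ R.posPart := Submodule.subset_span ⟨_, .gen i⟩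

theorem f_mem_negPart (i : ι) : R.f i ∈ R.negPart := Submodule.subset_span ⟨_, .gen i⟩

theorem e_lie_cartan_mem_posPart (i : ι) (h : H) : ⁅R.e i, R.cartan h⁆ ∈ R.posPart := by
  rw [← lie_skew]
  exact neg_mem (cartan_lie_mem_posPart h (e_mem_posPart i))

theorem f_lie_cartan_mem_negPart (i : ι) (h : H) : ⁅R.f i, R.cartan h⁆ ∈ R.negPart := by
  rw [← lie_skew]
  exact neg_mem (cartan_lie_mem_negPart h (f_mem_negPart i))

/-- Induction on length: in `⁅⁅e i, f j⁆, y⁆ + ⁅f j, ⁅e i, y⁆⁆` the first inner bracket is in the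
Cartan part, which preserves `negPart`; any Cartan term of `⁅e i, y⁆` becomes a multiple of `f j`.
-/
theorem e_lie_mem_of_mem_negPart (i : ι) {x : R.Algebra} (hx : x ∈ R.negPart) :
    ⁅R.e i, x⁆ ∈ R.cartanPart ⊔ R.negPart := by
  refine lie_mem_of_mem_span ?_ hx
  rintro x ⟨c, hc⟩
  induction hc with
  | gen j =>
    obtain ⟨h, hh⟩ := R.e_lie_f_mem_range i j
    exact Submodule.mem_sup_left ⟨h, hh.symm⟩
  | @lie j y c hy ih =>
    have hyN : y ∈ R.negPart := Submodule.subset_span ⟨c, hy⟩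
    obtain ⟨h, hh⟩ := R.e_lie_f_mem_range i j
    rw [leibniz_lie, hh]
    refine Submodule.mem_sup_right (add_mem (cartan_lie_mem_negPart h hyN) ?_)
    obtain ⟨_, ⟨k, rfl⟩, z, hz, hkz⟩ := Submodule.mem_sup.mp ih
    rw [← hkz, lie_add]
    exact add_mem (f_lie_cartan_mem_negPart j k) (f_lie_mem_negPart j hz)

theorem f_lie_mem_of_mem_posPart (i : ι) {x : R.Algebra} (hx : x ∈ R.posPart) :
    ⁅R.f i, x⁆ ∈ R.cartanPart ⊔ R.posPart := by
  refine lie_mem_of_mem_span ?_ hx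
  rintro x ⟨c, hc⟩
  induction hc with
  | gen j =>
    obtain ⟨h, hh⟩ := R.e_lie_f_mem_range j i
    rw [← lie_skew, hh]
    exact Submodule.mem_sup_left (neg_mem ⟨h, rfl⟩)
  | @lie j y c hy ih =>
    have hyN : y ∈ R.posPart := Submodule.subset_span ⟨c, hy⟩
    obtain ⟨h, hh⟩ := R.e_lie_f_mem_range j i
    rw [leibniz_lie, ← lie_skew (R.f i) (R.e j), hh, neg_lie]
    refine Submodule.mem_sup_right (add_mem (neg_mem (cartan_lie_mem_posPart h hyN)) ?_)
    obtain ⟨_, ⟨k, rfl⟩, z, hz, hkz⟩ := Submodule.mem_sup.mp ih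
    rw [← hkz, lie_add]
    exact add_mem (e_lie_cartan_mem_posPart j k) (e_lie_mem_posPart j hz)

-- The sum contains the generators and is stable under bracketing with them. Directness is not
-- needed.
variable (R) in
theorem cartanPart_sup_posPart_sup_negPart : R.cartanPart ⊔ R.posPart ⊔ R.negPart = ⊤ := by
  have hc : R.cartanPart ≤ R.cartanPart ⊔ R.posPart ⊔ R.negPart := le_sup_left.trans le_sup_left
  have hp : R.posPart ≤ R.cartanPart ⊔ R.posPart ⊔ R.negPart := le_sup_right.trans le_sup_left
  have hn : R.negPart ≤ R.cartanPart ⊔ R.posPart ⊔ R.negPart := le_sup_right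
  have key {a : R.Algebra} (h₁ : ∀ h, ⁅a, R.cartan h⁆ ∈ R.cartanPart ⊔ R.posPart ⊔ R.negPart)
      (h₂ : ∀ x ∈ R.posPart, ⁅a, x⁆ ∈ R.cartanPart ⊔ R.posPart ⊔ R.negPart)
      (h₃ : ∀ x ∈ R.negPart, ⁅a, x⁆ ∈ R.cartanPart ⊔ R.posPart ⊔ R.negPart) :
      ∀ x ∈ R.cartanPart ⊔ R.posPart ⊔ R.negPart,
        ⁅a, x⁆ ∈ R.cartanPart ⊔ R.posPart ⊔ R.negPart := by
    intro x hx
    obtain ⟨y, hy, z, hz, rfl⟩ := Submodule.mem_sup.mp hx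
    obtain ⟨_, ⟨k, rfl⟩, w, hw, rfl⟩ := Submodule.mem_sup.mp hy
    rw [lie_add, lie_add]
    exact add_mem (add_mem (h₁ k) (h₂ w hw)) (h₃ z hz)
  refine R.eq_top_of_generators_lie_mem _ (fun i => hp (e_mem_posPart i))
    (fun i => hn (f_mem_negPart i)) (fun h => hc ⟨h, rfl⟩)
    (fun i => key (fun h => hp (e_lie_cartan_mem_posPart i h))
      (fun x hx => hp (e_lie_mem_posPart i hx))
      (fun x hx => sup_le hc hn (e_lie_mem_of_mem_negPart i hx)))
    (fun i => key (fun h => hn (f_lie_cartan_mem_negPart i h))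
      (fun x hx => sup_le hc hp (f_lie_mem_of_mem_posPart i hx))
      (fun x hx => hn (f_lie_mem_negPart i hx)))
    (fun h => key (fun k => ?_) (fun x hx => hp (cartan_lie_mem_posPart h hx))
      (fun x hx => hn (cartan_lie_mem_negPart h hx)))
  rw [cartan_lie_cartan]
  exact zero_mem _

/-- A nonzero positive root space contains a nonzero positive monomial. -/
theorem exists_isPosMonomial_ne_zero {c : ι → ℕ} (hc : R.weight c ≠ 0)
    (h : R.rootSpace (R.weight c) ≠ ⊥) :
    ∃ x d, R.IsPosMonomial x d ∧ R.weight d = R.weight c ∧ x ≠ 0 := by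
  by_contra! hcon
  apply h
  have hdisj := R.iSupIndep_rootSpace (R.weight c)
  -- If every monomial of weight `weight c` vanishes, the other weight spaces span everything, and
  -- independence kills this one.
  suffices htop : ⨆ β, ⨆ (_ : β ≠ R.weight c), R.rootSpace β = ⊤ by
    rwa [htop, disjoint_top] at hdisj
  have hle {β : Module.Dual ℂ H} (hβ : β ≠ R.weight c) :
      R.rootSpace β ≤ ⨆ β, ⨆ (_ : β ≠ R.weight c), R.rootSpace β :=
    le_iSup₂_of_le β hβ le_rfl
  rw [eq_top_iff, ← R.cartanPart_sup_posPart_sup_negPart]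
  refine sup_le (sup_le ?_ (Submodule.span_le.mpr ?_)) (Submodule.span_le.mpr ?_)
  · rintro _ ⟨k, rfl⟩
    exact hle hc.symm (cartan_mem_rootSpace k)
  · rintro x ⟨d, hd⟩
    by_cases hdc : R.weight d = R.weight c
    · rw [hcon x d hd hdc]
      exact zero_mem _
    · exact hle hdc hd.mem_rootSpace
  · rintro x ⟨d, hd⟩
    exact hle (R.weight_ne_neg_weight hc).symm hd.mem_rootSpace

end Monomials

/-! ### Brackets of root vectors of height one -/

variable (R) in
/-- Iterated brackets `⁅z_m, ⁅…, ⁅z_2, z_1⁆⁆⁆` of `m` weight vectors of `I`-height one. -/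
inductive IsUnitChain (I : Set ι) : R.Algebra → (ι → ℕ) → ℕ → Prop
  | base {x : R.Algebra} {c : ι → ℕ} (hx : x ∈ R.rootSpace (R.weight c))
      (hc : tupleHeight I c = 1) : IsUnitChain I x c 1
  | lie {z x : R.Algebra} {d c : ι → ℕ} {m : ℕ} (hz : z ∈ R.rootSpace (R.weight d))
      (hd : tupleHeight I d = 1) (hx : IsUnitChain I x c m) :
      IsUnitChain I ⁅z, x⁆ (d + c) (m + 1)

variable {I : Set ι}

theorem IsUnitChain.mem_rootSpace {x : R.Algebra} {c : ι → ℕ} {m : ℕ}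
    (hx : R.IsUnitChain I x c m) : x ∈ R.rootSpace (R.weight c) := by
  induction hx with
  | base hx _ => exact hx
  | lie hz _ _ ih => exact lie_mem_rootSpace_weight hz ih

variable (R I) in
/-- The span of the chains of given length and weight. -/
def unitChainSpan (c : ι → ℕ) (m : ℕ) : Submodule ℂ R.Algebra :=
  Submodule.span ℂ {x | R.IsUnitChain I x c m}

theorem lie_mem_unitChainSpan {z x : R.Algebra} {d c : ι → ℕ} {m : ℕ}
    (hz : z ∈ R.rootSpace (R.weight d)) (hd : tupleHeight I d = 1)
    (hx : x ∈ R.unitChainSpan I c m) : ⁅z, x⁆ ∈ R.unitChainSpan I (d + c) (m + 1) :=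
  lie_mem_of_mem_span (fun _ hy => Submodule.subset_span (.lie hz hd hy)) hx

/-- Bracketing with a weight vector of `I`-height zero preserves spans of chains. -/
theorem lie_mem_unitChainSpan_of_tupleHeight_eq_zero {z x : R.Algebra} {d c : ι → ℕ} {m : ℕ}
    (hz : z ∈ R.rootSpace (R.weight d)) (hd : tupleHeight I d = 0)
    (hx : x ∈ R.unitChainSpan I c m) : ⁅z, x⁆ ∈ R.unitChainSpan I (d + c) m := by
  refine lie_mem_of_mem_span (fun y hy => ?_) hx
  clear hx
  rw [Set.mem_ofPred_eq] at hy
  induction hy with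
  | base hx hc =>
    exact Submodule.subset_span
      (.base (lie_mem_rootSpace_weight hz hx) (by rw [tupleHeight_add, hd, hc]))
  | @lie w y a b m hw ha hy ih =>
    -- The height-zero vector either joins the outer factor, which keeps height one, or moves on to
    -- the shorter chain.
    rw [leibniz_lie]
    refine add_mem ?_ ?_
    · rw [← add_assoc]
      exact Submodule.subset_span (.lie (lie_mem_rootSpace_weight hz hw)
        (by rw [tupleHeight_add, hd, ha]) hy)
    · rw [add_left_comm]
      exact lie_mem_unitChainSpan hw ha ih

/-- A factor `e i` lengthens chains by one if `i ∈ I` and is absorbed otherwise. When `i ∈ I` meets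
a monomial of height zero there is no chain to extend, and the whole bracket is a chain of length
one. -/
theorem IsPosMonomial.mem_unitChainSpan [DecidableEq ι] {x : R.Algebra} {c : ι → ℕ}
    (hx : R.IsPosMonomial x c) (hc : 0 < tupleHeight I c) : x ∈ R.unitChainSpan I c (tupleHeight I c) := by
  have unit {x : R.Algebra} {c : ι → ℕ} (hx : R.IsPosMonomial x c) (hc : tupleHeight I c = 1) :
      x ∈ R.unitChainSpan I c (tupleHeight I c) := by
    rw [hc]
    exact Submodule.subset_span (.base hx.mem_rootSpace hc)
  induction hx with
  | gen i =>
    by_cases hi : i ∈ I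
    · exact unit (.gen i) (tupleHeight_single_of_mem hi)
    · rw [tupleHeight_single_of_notMem hi] at hc
      omega
  | @lie i y c hy ih =>
    have hei : R.e i ∈ R.rootSpace (R.weight (Pi.single i 1)) := (IsPosMonomial.gen i).mem_rootSpace
    by_cases hi : i ∈ I
    · have h1 := tupleHeight_single_of_mem hi
      rcases Nat.eq_zero_or_pos (tupleHeight I c) with h0 | h0
      · exact unit (hy.lie i) (by rw [tupleHeight_add, h1, h0])
      · rw [tupleHeight_add, h1, add_comm 1]
        exact lie_mem_unitChainSpan hei h1 (ih h0)
    · have h1 := tupleHeight_single_of_notMem hi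
      rw [tupleHeight_add, h1, zero_add] at hc ⊢
      exact lie_mem_unitChainSpan_of_tupleHeight_eq_zero hei h1 (ih hc)

/-! ### From a nonzero chain to a sequence of roots. -/

theorem weight_mem_posRoots {x : R.Algebra} {c : ι → ℕ} (hx : x ∈ R.rootSpace (R.weight c))
    (hx0 : x ≠ 0) (hc : tupleHeight I c ≠ 0) : R.weight c ∈ R.posRoots := by
  refine ⟨⟨fun h0 => hc ?_, fun hbot => hx0 ?_⟩, c, rfl⟩
  · have h := R.heightOn_weight I c
    have h' := R.heightOn_weight I 0
    rw [h0, show (0 : Module.Dual ℂ H) = R.weight 0 by simp [weight], h'] at h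
    have h'' : tupleHeight I (0 : ι → ℕ) = tupleHeight I c := by exact_mod_cast h
    rw [← h'']
    simp [tupleHeight]
  · rw [hbot] at hx
    exact (Submodule.mem_bot ℂ).mp hx

/-- A nonzero bracket has nonzero entries, so nonvanishing passes inward to every factor and every
inner chain. -/
theorem IsUnitChain.exists_unitRoots {x : R.Algebra} {c : ι → ℕ} {m : ℕ}
    (hx : R.IsUnitChain I x c m) (hx0 : x ≠ 0) :
    ∃ γ : ℕ → Module.Dual ℂ H,
      (∀ j ∈ Finset.Icc 1 m, γ j ∈ R.unitRoots I) ∧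
      R.weight c = ∑ j ∈ Finset.Icc 1 m, γ j ∧
      ∀ i ∈ Finset.Icc 1 m, (∑ j ∈ Finset.Icc 1 i, γ j) ∈ R.posRoots := by
  have unit {x : R.Algebra} {c : ι → ℕ} (hx : x ∈ R.rootSpace (R.weight c)) (hx0 : x ≠ 0)
      (hc : tupleHeight I c = 1) : R.weight c ∈ R.unitRoots I :=
    ⟨(weight_mem_posRoots hx hx0 (I := I) (by omega)).1, by
      rw [heightOn_weight, hc, Nat.cast_one]⟩
  induction hx with
  | @base x c hx hc =>
    refine ⟨fun _ => R.weight c, fun _ _ => unit hx hx0 hc, by simp, fun i hi => ?_⟩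
    obtain rfl : i = 1 := by simpa using hi
    simpa using weight_mem_posRoots hx hx0 (I := I) (by omega)
  | @lie z y d c m hz hd hy ih =>
    have hy0 : y ≠ 0 := by
      rintro rfl
      exact hx0 (lie_zero z)
    have hz0 : z ≠ 0 := by
      rintro rfl
      exact hx0 (zero_lie y)
    obtain ⟨γ, hγ, hsum, hpart⟩ := ih hy0
    -- The new root is placed at index `m + 1`, outside the range of the earlier partial sums.
    have hpartial {i : ℕ} (hi : i ≤ m) :
        ∑ j ∈ Finset.Icc 1 i, Function.update γ (m + 1) (R.weight d) j =
          ∑ j ∈ Finset.Icc 1 i, γ j := by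
      refine Finset.sum_congr rfl fun j hj => Function.update_of_ne ?_ _ _
      have := (Finset.mem_Icc.mp hj).2
      omega
    have htotal : R.weight (d + c) =
        ∑ j ∈ Finset.Icc 1 (m + 1), Function.update γ (m + 1) (R.weight d) j := by
      rw [Finset.sum_Icc_succ_top (by omega), hpartial le_rfl, Function.update_self, ← hsum,
        weight_add, add_comm]
    refine ⟨Function.update γ (m + 1) (R.weight d), fun j hj => ?_, htotal, fun i hi => ?_⟩
    · rw [Finset.mem_Icc] at hj
      rcases Nat.eq_or_lt_of_le hj.2 with rfl | hlt
      · rw [Function.update_self]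
        exact unit hz hz0 hd
      · rw [Function.update_of_ne hlt.ne]
        exact hγ j (Finset.mem_Icc.mpr (by omega))
    · rw [Finset.mem_Icc] at hi
      rcases Nat.eq_or_lt_of_le hi.2 with rfl | hlt
      · rw [← htotal]
        refine weight_mem_posRoots (I := I) (lie_mem_rootSpace_weight hz hy.mem_rootSpace) hx0 ?_
        rw [tupleHeight_add, hd]
        omega
      · rw [hpartial (by omega)]
        exact hpart i (Finset.mem_Icc.mpr (by omega))

end Realization

end KacMoody

end

theorem theorem2p1 {ι : Type*} [Fintype ι] [DecidableEq ι] (A : Matrix ι ι ℤ)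
    (hA : KacMoody.IsFiniteType A ∨ KacMoody.IsAffineType A)
    {H : Type*} [AddCommGroup H] [Module ℂ H] (R : KacMoody.Realization A H)
    (I : Set ι) (hI : I.Nonempty)
    (β : Module.Dual ℂ H) (hβ : β ∈ R.posRoots)
    (m : ℕ) (hm : 0 < m) (hβm : R.heightOn I β = (m : ℂ)) :
    ∃ γ : ℕ → Module.Dual ℂ H,
      (∀ j ∈ Finset.Icc 1 m, γ j ∈ R.unitRoots I) ∧
      β = ∑ j ∈ Finset.Icc 1 m, γ j ∧
      ∀ i ∈ Finset.Icc 1 m, (∑ j ∈ Finset.Icc 1 i, γ j) ∈ R.posRoots := by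
  obtain ⟨⟨hβ0, hβbot⟩, c, rfl⟩ := hβ
  obtain ⟨x, d, hx, hdc, hx0⟩ :=
    KacMoody.Realization.exists_isPosMonomial_ne_zero (c := c) hβ0 hβbot
  change R.heightOn I (R.weight c) = _ at hβm
  -- Equality of weights suffices to give `d` height `m`; `d = c` is not needed.
  rw [← hdc, R.heightOn_weight] at hβm
  obtain rfl : KacMoody.Realization.tupleHeight I d = m := by exact_mod_cast hβm
  obtain ⟨y, hy, hy0⟩ : ∃ y, R.IsUnitChain I y d (KacMoody.Realization.tupleHeight I d) ∧ y ≠ 0 := by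
    -- Were all chains of this weight and length zero, their span, which contains `x`, would be
    -- zero.
    by_contra! hcon
    have hbot : R.unitChainSpan I d (KacMoody.Realization.tupleHeight I d) = ⊥ :=
      Submodule.span_eq_bot.mpr hcon
    exact hx0 ((Submodule.mem_bot ℂ).mp (hbot ▸ hx.mem_unitChainSpan hm))
  have hγ := hy.exists_unitRoots hy0
  rwa [hdc] at hγ
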